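/- Let $m\ge 1$, let $E_1,\dots,E_m,F$ be (real) Banach lattices, let $A\colon E_1\times\cdots\times E_m\to F$ be a regular $m$-linear operator (a difference of two positive $m$-linear operators), and let $\rho$ be a permutation of $\{1,\dots,m\}$. The Arens extension of $A$ with respect to $\rho$ is the $m$-linear operator $AR_m^\rho(A)\colon E_1^{**}\times\cdots\times E_m^{**}\to F^{**}$ given by $$AR_m^\rho(A)(x_1^{**},\dots,x_m^{**})(y^*)=\big(\overline{x_{\rho(m)}^{**}}^{\rho}\circ\cdots\circ\overline{x_{\rho(1)}^{**}}^{\rho}\big)(y^*\circ A)\qquad(y^*\in F^*),$$ where $\overline{x_{\rho(k)}^{**}}^{\rho}$ maps a regular form $B$ in the variables $x_i\in E_i$, $i\notin\{\rho(1),\dots,\rho(k-1)\}$, to the form in the variables $x_i$, $i\notin\{\rho(1),\dots,\rho(k)\}$, whose value is obtained by applying $x_{\rho(k)}^{**}$ to the functional $x_{\rho(k)}\mapsto B(\dots,x_{\rho(k)},\dots)$ in $E_{\rho(k)}^*$ (the remaining variables being fixed). If $E_j^*$ has order continuous norm for every $j\in\{1,\dots,m\}$ with $j\neq\rho(1)$,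 then $AR_m^\rho(A)$ is separately order continuous on $E_1^{**}\times\cdots\times E_m^{**}$; that is, for every $j$ and all fixed $x_k^{**}\in E_k^{**}$, $k\neq j$, the linear operator $x_j^{**}\in E_j^{**}\mapsto AR_m^\rho(A)(x_1^{**},\dots,x_m^{**})\in F^{**}$ maps every net that is order convergent to $0$ to a net that is order convergent to $0$. Here a net $(x_\alpha)$ is order convergent to $0$ if there is a net $(y_\alpha)$ over the same directed set with $y_\alpha\downarrow 0$ and $|x_\alpha|\le y_\alpha$ for all $\alpha$, and a norm is order continuous if $x_\alpha\downarrow 0$ implies $\|x_\alpha\|\to 0$. -/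

import Mathlib

open Filter Topology

universe u v w

noncomputable section

/-! ### Duals of ordered normed spaces -/

/-- The order of the dual `E*`: `f ≤ g` iff `f x ≤ g x` for all `x ≥ 0`. For a Banach lattice `E`
this is the lattice order of the Banach lattice `E*`. -/
instance dualPreorder (E : Type u) [NormedAddCommGroup E] [NormedSpace ℝ E] [Preorder E] :
    Preorder (StrongDual ℝ E) where
  le f g := ∀ x : E, 0 ≤ x → f x ≤ g x
  le_refl _ _ _ := le_rfl
  le_trans _ _ _ hfg hgh x hx := (hfg x hx).trans (hgh x hx)

/-- The bidual `E**`, with the bidual norm and the bidual order. -/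
abbrev Bidual (E : Type u) [NormedAddCommGroup E] [NormedSpace ℝ E] : Type u :=
  StrongDual ℝ (StrongDual ℝ E)

/-! ### Order convergence and order continuity

In a Riesz space, `|x| ≤ y` means exactly `-y ≤ x` and `x ≤ y`. The definitions are written in
this form, so that they refer to the order only. -/

/-- `y_α ↓ 0`: the net `y` is decreasing and its infimum is `0`. -/
def DecreasesToZero {E : Type u} [AddCommGroup E] [Preorder E] {Ω : Type w} [Preorder Ω]
    (y : Ω → E) : Prop :=
  Antitone y ∧ IsGLB (Set.range y) 0

/-- The net `x` is order convergent to `0`: there is a net `y` over the same directed set with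
`y_α ↓ 0` and `|x_α| ≤ y_α` for every `α`. -/
def OrderConvergesToZero {E : Type u} [AddCommGroup E] [Preorder E] {Ω : Type w} [Preorder Ω]
    (x : Ω → E) : Prop :=
  ∃ y : Ω → E, DecreasesToZero y ∧ ∀ α, -y α ≤ x α ∧ x α ≤ y α

/-- A linear operator is order continuous if it maps nets that are order convergent to `0` to nets
that are order convergent to `0`. The index sets of the nets are arbitrary directed sets in the
universe `w`. -/
def OrderContinuous {E : Type u} {F : Type v} [AddCommGroup E] [Module ℝ E] [Preorder E]
    [AddCommGroup F] [Module ℝ F] [Preorder F] (T : E →ₗ[ℝ] F) : Prop :=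
  ∀ (Ω : Type w) [Preorder Ω] [IsDirectedOrder Ω] [Nonempty Ω] (x : Ω → E),
    OrderConvergesToZero x → OrderConvergesToZero fun α => T (x α)

/-- A multilinear operator is separately order continuous if, for every `j` and every choice of the
other variables, it is order continuous as a linear operator of the `j`-th variable. -/
def SeparatelyOrderContinuous {m : ℕ} {E : Fin m → Type u} {F : Type v}
    [∀ i, AddCommGroup (E i)] [∀ i, Module ℝ (E i)] [∀ i, Preorder (E i)]
    [AddCommGroup F] [Module ℝ F] [Preorder F] (A : MultilinearMap ℝ E F) : Prop :=
  ∀ (j : Fin m) (x : ∀ i, E i), OrderContinuous.{u, v, w} (A.toLinearMap x j)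

/-- The norm of `X` is order continuous: `x_α ↓ 0` implies `‖x_α‖ → 0`. It suffices to consider
directed sets in the universe of `X`, because the range of a decreasing net is one. -/
def HasOrderContinuousNorm (X : Type u) [NormedAddCommGroup X] [Preorder X] : Prop :=
  ∀ (Ω : Type u) [Preorder Ω] [IsDirectedOrder Ω] [Nonempty Ω] (x : Ω → X),
    DecreasesToZero x → Tendsto (fun α => ‖x α‖) atTop (𝓝 0)

/-! ### Regular multilinear operators -/

/-- An operator is positive if it is nonnegative on tuples of nonnegative vectors. -/
def IsPositiveMultilinear {m : ℕ} {E : Fin m → Type u} {F : Type v}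
    [∀ i, AddCommGroup (E i)] [∀ i, Module ℝ (E i)] [∀ i, Preorder (E i)]
    [AddCommGroup F] [Module ℝ F] [Preorder F] (A : MultilinearMap ℝ E F) : Prop :=
  ∀ x : ∀ i, E i, (∀ i, 0 ≤ x i) → 0 ≤ A x

/-- An operator is regular if it is the difference of two positive operators. -/
def IsRegularMultilinear {m : ℕ} {E : Fin m → Type u} {F : Type v}
    [∀ i, AddCommGroup (E i)] [∀ i, Module ℝ (E i)] [∀ i, Preorder (E i)]
    [AddCommGroup F] [Module ℝ F] [Preorder F] (A : MultilinearMap ℝ E F) : Prop :=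
  ∃ A₁ A₂ : MultilinearMap ℝ E F,
    IsPositiveMultilinear A₁ ∧ IsPositiveMultilinear A₂ ∧ A = A₁ - A₂

section AutomaticContinuity

variable {m : ℕ} {E : Fin m → Type u} {F : Type v}
  [∀ i, NormedAddCommGroup (E i)] [∀ i, NormedSpace ℝ (E i)]
  [∀ i, Lattice (E i)] [∀ i, IsOrderedAddMonoid (E i)]
  [NormedAddCommGroup F] [NormedSpace ℝ F]
  [Lattice F] [IsOrderedAddMonoid F]

theorem IsPositiveMultilinear.mono {A : MultilinearMap ℝ E F} (hA : IsPositiveMultilinear A)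
    {x y : ∀ i, E i} (hx : ∀ i, 0 ≤ x i) (hxy : ∀ i, x i ≤ y i) : A x ≤ A y := by
  classical
  have hy : y = x + (y - x) := by simp
  rw [hy, A.map_add_univ]
  have h := Finset.single_le_sum (s := (Finset.univ : Finset (Finset (Fin m))))
    (f := fun s => A (s.piecewise x (y - x))) (fun s _ => hA _ fun i => by
      by_cases hi : i ∈ s
      · simpa [hi] using hx i
      · simpa [hi] using hxy i) (Finset.mem_univ Finset.univ)
  simpa using h

variable [∀ i, CompleteSpace (E i)] [∀ i, IsOrderedModule ℝ (E i)] [∀ i, HasSolidNorm (E i)]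
  [HasSolidNorm F]

theorem IsPositiveMultilinear.exists_bound_nonneg {A : MultilinearMap ℝ E F}
    (hA : IsPositiveMultilinear A) :
    ∃ C : ℝ, ∀ x : ∀ i, E i, (∀ i, 0 ≤ x i) → (∀ i, ‖x i‖ ≤ 1) → ‖A x‖ ≤ C := by
  by_contra! h
  choose x hx0 hx1 hxA using fun n : ℕ => h ((n : ℝ) * (2 : ℝ) ^ (n * m))
  have hterm0 : ∀ i n, 0 ≤ ((1 / 2 : ℝ) ^ n) • x n i := fun i n =>
    smul_nonneg (by positivity) (hx0 n i)
  have hsum : ∀ i, Summable fun n => ((1 / 2 : ℝ) ^ n) • x n i := fun i => by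
    refine Summable.of_norm_bounded (g := fun n : ℕ => (1 / 2 : ℝ) ^ n)
      (summable_geometric_of_lt_one (by norm_num) (by norm_num)) fun n => ?_
    rw [norm_smul, Real.norm_of_nonneg (by positivity)]
    exact mul_le_of_le_one_right (by positivity) (hx1 n i)
  let s : ∀ i, E i := fun i => ∑' n, ((1 / 2 : ℝ) ^ n) • x n i
  have hle : ∀ n i, ((1 / 2 : ℝ) ^ n) • x n i ≤ s i := fun n i =>
    (hsum i).le_tsum n fun k _ => hterm0 i k
  obtain ⟨n, hn⟩ := exists_nat_gt ‖A s‖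
  have h1 := hA.mono (hterm0 · n) (hle n)
  have h2 : (0 : F) ≤ A fun i => ((1 / 2 : ℝ) ^ n) • x n i := hA _ (hterm0 · n)
  have h3 := norm_le_norm_of_abs_le_abs
    (by rwa [abs_of_nonneg h2, abs_of_nonneg (h2.trans h1)] :
      |A fun i => ((1 / 2 : ℝ) ^ n) • x n i| ≤ |A s|)
  rw [A.map_smul_univ, norm_smul, Finset.prod_const, Finset.card_univ, Fintype.card_fin,
    ← pow_mul, Real.norm_of_nonneg (by positivity)] at h3
  have h4 := mul_lt_mul_of_pos_left (hxA n) (by positivity : (0 : ℝ) < (1 / 2) ^ (n * m))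
  have h5 : (1 / 2 : ℝ) ^ (n * m) * ((n : ℝ) * 2 ^ (n * m)) = n := by
    rw [mul_left_comm, ← mul_pow]
    norm_num
  linarith

/-- A positive multilinear operator between Banach lattices is continuous. -/
theorem IsPositiveMultilinear.continuous {A : MultilinearMap ℝ E F}
    (hA : IsPositiveMultilinear A) : Continuous A := by
  classical
  obtain ⟨C, hC⟩ := hA.exists_bound_nonneg
  have key : ∀ x : ∀ i, E i, (∀ i, ‖x i‖ ≤ 1) →
      ‖A x‖ ≤ ∑ _s : Finset (Fin m), C := fun x hx => by
    have hdec : x = (fun i => (x i)⁺) + fun i => (-1 : ℝ) • (x i)⁻ := by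
      ext i
      simp only [Pi.add_apply, neg_smul, one_smul, ← sub_eq_add_neg, posPart_sub_negPart]
    rw [hdec, A.map_add_univ]
    refine norm_sum_le_of_le _ fun s _ => ?_
    have hs : (s.piecewise (fun i => (x i)⁺) fun i => (-1 : ℝ) • (x i)⁻) =
        fun i => (if i ∈ s then (1 : ℝ) else -1) • (s.piecewise (fun i => (x i)⁺)
          (fun i => (x i)⁻) i) := by
      ext i
      by_cases hi : i ∈ s <;> simp [hi]
    rw [hs, A.map_smul_univ, norm_smul, norm_prod]
    have hp : ∏ i : Fin m, ‖(if i ∈ s then (1 : ℝ) else -1)‖ = 1 :=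
      Finset.prod_eq_one fun i _ => by split_ifs <;> simp
    rw [hp, one_mul]
    refine hC _ (fun i => ?_) fun i => ?_
    · by_cases hi : i ∈ s
      · simp [hi, posPart_nonneg]
      · simp [hi, negPart_nonneg]
    · refine le_trans (norm_le_norm_of_abs_le_abs ?_) (hx i)
      by_cases hi : i ∈ s
      · rw [Finset.piecewise_eq_of_mem _ _ _ hi, abs_of_nonneg (posPart_nonneg _),
          ← posPart_add_negPart]
        exact le_add_of_nonneg_right (negPart_nonneg _)
      · rw [Finset.piecewise_eq_of_notMem _ _ _ hi, abs_of_nonneg (negPart_nonneg _),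
          ← posPart_add_negPart]
        exact le_add_of_nonneg_left (posPart_nonneg _)
  refine (A.mkContinuous (∑ _s : Finset (Fin m), C) fun x => ?_).cont
  have hxu : x = fun i => ‖x i‖ • (‖x i‖⁻¹ • x i) := by
    ext i
    by_cases hi : x i = 0
    · simp [hi]
    · rw [smul_smul, mul_inv_cancel₀ (norm_ne_zero_iff.mpr hi), one_smul]
  have h1 : A x = (∏ i, ‖x i‖) • A fun i => ‖x i‖⁻¹ • x i := by
    conv_lhs => rw [hxu]
    exact A.map_smul_univ _ _
  rw [h1, norm_smul, norm_prod, mul_comm]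
  simp only [norm_norm]
  refine mul_le_mul_of_nonneg_right (key _ fun i => ?_) (by positivity)
  rw [norm_smul, norm_inv, norm_norm]
  exact inv_mul_le_one

theorem IsRegularMultilinear.continuous {A : MultilinearMap ℝ E F}
    (hA : IsRegularMultilinear A) : Continuous A := by
  obtain ⟨A₁, A₂, h₁, h₂, rfl⟩ := hA
  exact h₁.continuous.sub h₂.continuous

end AutomaticContinuity

/-! ### Arens extensions -/

section Arens

/-- For a functional `z` in the bidual of the first factor and a form `B`, the form
`(x₁, …, xₙ) ↦ z (B (•, x₁, …, xₙ))` in the remaining variables. -/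
def arensStep {n : ℕ} {G : Fin (n + 1) → Type u} [∀ i, NormedAddCommGroup (G i)]
    [∀ i, NormedSpace ℝ (G i)] (z : Bidual (G 0)) :
    ContinuousMultilinearMap ℝ G ℝ →L[ℝ]
      ContinuousMultilinearMap ℝ (fun i : Fin n => G i.succ) ℝ :=
  (ContinuousLinearMap.compContinuousMultilinearMapL ℝ (fun i : Fin n => G i.succ)
      (StrongDual ℝ (G 0)) ℝ z).comp
    (((ContinuousLinearMap.flipMultilinearEquiv ℝ (fun i : Fin n => G i.succ) (G 0) ℝ
        ).toContinuousLinearMap).comp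
      (continuousMultilinearCurryLeftEquiv ℝ G ℝ).toContinuousLinearEquiv.toContinuousLinearMap)

theorem arensStep_apply {n : ℕ} {G : Fin (n + 1) → Type u} [∀ i, NormedAddCommGroup (G i)]
    [∀ i, NormedSpace ℝ (G i)] (z : Bidual (G 0)) (B : ContinuousMultilinearMap ℝ G ℝ)
    (x : ∀ i : Fin n, G i.succ) :
    arensStep z B x = z (B.curryLeft.flipMultilinear x) := rfl

/-- The functional `B ↦ (z̄ₙ ∘ ⋯ ∘ z̄₁) B` on forms, where `z̄` denotes `arensStep z`: the variables
are eliminated one after the other, beginning with the first. -/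
def arensForm : {n : ℕ} → (G : Fin n → Type u) → [∀ i, NormedAddCommGroup (G i)] →
    [∀ i, NormedSpace ℝ (G i)] → (∀ i, Bidual (G i)) →
    (ContinuousMultilinearMap ℝ G ℝ →L[ℝ] ℝ)
  | 0, G, _, _, _ => ContinuousMultilinearMap.apply ℝ G ℝ 0
  | n + 1, G, _, _, z =>
    (arensForm (fun i : Fin n => G i.succ) fun i => z i.succ).comp (arensStep (z 0))

/-- `arensForm`, as a multilinear map of the functionals. -/
def arensFormMultilinear {n : ℕ} (G : Fin n → Type u) [∀ i, NormedAddCommGroup (G i)]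
    [∀ i, NormedSpace ℝ (G i)] :
    MultilinearMap ℝ (fun i => Bidual (G i)) (ContinuousMultilinearMap ℝ G ℝ →L[ℝ] ℝ) where
  toFun := arensForm G
  map_update_add' := by
    intro inst z i a b
    obtain rfl : inst = instDecidableEqFin n := Subsingleton.elim _ _
    induction n with
    | zero => exact i.elim0
    | succ n ih =>
      ext B
      refine Fin.cases (fun a b => ?_) (fun i a b => ?_) i a b
      · have h : arensStep (a + b) B = arensStep a B + arensStep b B := by
          ext x; simp [arensStep_apply]
        simp [arensForm, h]
      · have h := fun c : Bidual (G i.succ) => (Fin.tail_update_succ z i c)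
        have h0 : ∀ c : Bidual (G i.succ), Function.update z i.succ c 0 = z 0 := fun c =>
          Function.update_of_ne (Fin.succ_ne_zero i).symm c z
        simp only [Fin.tail_def] at h
        simp only [arensForm, h, h0, ih]
        simp
  map_update_smul' := by
    intro inst z i c a
    obtain rfl : inst = instDecidableEqFin n := Subsingleton.elim _ _
    induction n with
    | zero => exact i.elim0
    | succ n ih =>
      ext B
      refine Fin.cases (fun a => ?_) (fun i a => ?_) i a
      · have h : arensStep (c • a) B = c • arensStep a B := by
          ext x; simp [arensStep_apply]
        simp [arensForm, h]
      · have h := fun c : Bidual (G i.succ) => (Fin.tail_update_succ z i c)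
        have h0 : ∀ c : Bidual (G i.succ), Function.update z i.succ c 0 = z 0 := fun c =>
          Function.update_of_ne (Fin.succ_ne_zero i).symm c z
        simp only [Fin.tail_def] at h
        simp only [arensForm, h, h0, ih]
        simp

variable {m : ℕ} {E : Fin m → Type u} {F : Type v}
  [∀ i, NormedAddCommGroup (E i)] [∀ i, NormedSpace ℝ (E i)]
  [NormedAddCommGroup F] [NormedSpace ℝ F]

/-- The operator `A` with its variables listed in the order `ρ(1), …, ρ(m)`: the value at
`(x (ρ 1), …, x (ρ m))` is `A (x 1, …, x m)`. -/
def permuteVariables (ρ : Equiv.Perm (Fin m)) (A : ContinuousMultilinearMap ℝ E F) :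
    ContinuousMultilinearMap ℝ (fun k => E (ρ k)) F where
  toMultilinearMap := MultilinearMap.domDomCongrLinearEquiv' ℝ ℝ E F ρ.symm A.toMultilinearMap
  cont := A.cont.comp <| continuous_pi fun i => by
    obtain ⟨k, rfl⟩ := ρ.surjective i
    have h : (fun x : ∀ k, E (ρ k) => (ρ.symm.piCongrLeft' E).symm x (ρ k)) = fun x => x k := by
      ext x
      exact Equiv.piCongrLeft_apply_apply E ρ x k
    exact h ▸ continuous_apply k

theorem permuteVariables_apply (ρ : Equiv.Perm (Fin m)) (A : ContinuousMultilinearMap ℝ E F)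
    (x : ∀ i, E i) : permuteVariables ρ A (fun k => x (ρ k)) = A x :=
  congrArg A ((ρ.symm.piCongrLeft' E).symm_apply_apply x)

/-- The Arens extension of a continuous multilinear operator with respect to `ρ`: its value at
`(z 1, …, z m)` is the functional that maps `y` in `F*` to the number obtained from the form
`y ∘ A` by applying `z (ρ 1)` to its `ρ 1`-th variable, then `z (ρ 2)` to its `ρ 2`-th variable,
and so on up to `z (ρ m)`. -/
def arensExtensionOfContinuous (ρ : Equiv.Perm (Fin m)) (A : ContinuousMultilinearMap ℝ E F) :
    MultilinearMap ℝ (fun i => Bidual (E i)) (Bidual F) :=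
  (MultilinearMap.domDomCongrLinearEquiv' ℝ ℝ (fun i => Bidual (E i)) (Bidual F) ρ.symm).symm
    (((ContinuousLinearMap.compL ℝ (StrongDual ℝ F)
        (ContinuousMultilinearMap ℝ (fun k => E (ρ k)) ℝ) ℝ).flip
      ((ContinuousLinearMap.compContinuousMultilinearMapL ℝ (fun k => E (ρ k)) F ℝ).flip
        (permuteVariables ρ A))).toLinearMap.compMultilinearMap
      (arensFormMultilinear fun k => E (ρ k)))

theorem arensExtensionOfContinuous_apply (ρ : Equiv.Perm (Fin m))
    (A : ContinuousMultilinearMap ℝ E F) (z : ∀ i, Bidual (E i)) (y : StrongDual ℝ F) :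
    arensExtensionOfContinuous ρ A z y =
      arensForm (fun k => E (ρ k)) (fun k => z (ρ k))
        (y.compContinuousMultilinearMap (permuteVariables ρ A)) := rfl

/-- The Arens extension `AR_m^ρ(A) : E₁** × ⋯ × E_m** → F**` of a regular multilinear operator `A`
between Banach lattices. -/
def arensExtension [∀ i, CompleteSpace (E i)] [∀ i, Lattice (E i)]
    [∀ i, IsOrderedAddMonoid (E i)] [∀ i, IsOrderedModule ℝ (E i)] [∀ i, HasSolidNorm (E i)]
    [Lattice F] [IsOrderedAddMonoid F] [HasSolidNorm F]
    (ρ : Equiv.Perm (Fin m)) (A : MultilinearMap ℝ E F) (hA : IsRegularMultilinear A) :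
    MultilinearMap ℝ (fun i => Bidual (E i)) (Bidual F) :=
  arensExtensionOfContinuous ρ { toMultilinearMap := A, cont := hA.continuous }

end Arens

end

/-! Write `A = A₁ - A₂` with positive parts and put `S = A₁ + A₂`. If `|z i| ≤ u i` for the fixed
variables and `|v α| ≤ y α` with `y α ↓ 0` for the `j`-th one, every elimination step preserves
domination on positive tuples (`abs_arensForm_le`). Hence the extension of `S` at `u` and `y α`
dominates the extension of `A` at `z` and `v α`. It remains to see that this dominating net
decreases to zero; by monotonicity and `decreasesToZero_of_tendsto_apply`, it is enough to test it
on positive `f` in `F*`.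

Eliminating the variables before the `j`-th leaves a positive form. Applying `y α` gives forms that
decrease to zero pointwise on positive tuples, since order convergence of a decreasing net in a dual
is pointwise convergence on the cone (`DecreasesToZero.tendsto_apply`). Each later elimination
preserves this: the partial functionals decrease to zero in a dual with order continuous norm, so
they converge in norm, and the next functional is norm continuous. Only variables after the `j`-th
need this hypothesis, and `ρ(1)` is never among them.

No modulus on the duals is needed. `HasPositiveDecomposition` and `HasNormalNorm` are dual
properties: each one for `X` gives the other for `X*`, so both pass from Banach lattices to the
duals and biduals. -/

/-! ### Ordered normed groups -/

section OrderedNormedGroup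

variable {X : Type u} [NormedAddCommGroup X] [Preorder X]

/-- Every vector is a difference of two positive vectors of at most the same norm. -/
def HasPositiveDecomposition (X : Type u) [NormedAddCommGroup X] [Preorder X] : Prop :=
  ∀ x : X, ∃ a b : X, 0 ≤ a ∧ 0 ≤ b ∧ ‖a‖ ≤ ‖x‖ ∧ ‖b‖ ≤ ‖x‖ ∧ x = a - b

/-- If `b ≤ x ≤ a`, then `‖x‖ ≤ ‖a‖ + ‖b‖`. -/
def HasNormalNorm (X : Type u) [NormedAddCommGroup X] [Preorder X] : Prop :=
  ∀ a x b : X, b ≤ x → x ≤ a → ‖x‖ ≤ ‖a‖ + ‖b‖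

theorem HasPositiveDecomposition.exists_abs_le [IsOrderedAddMonoid X]
    (hX : HasPositiveDecomposition X) (x : X) : ∃ u : X, -u ≤ x ∧ x ≤ u := by
  obtain ⟨a, b, ha, hb, -, -, rfl⟩ := hX x
  refine ⟨a + b, ?_, ?_⟩
  · rw [neg_add', sub_eq_add_neg, sub_eq_add_neg]
    exact add_le_add_left (neg_le_self ha) _
  · exact (sub_le_self a hb).trans (le_add_of_nonneg_right hb)

/-- The distance from `x` to the negative cone. -/
noncomputable def distNegCone (x : X) : ℝ := ⨅ h : {h : X // 0 ≤ h}, ‖x + h‖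

theorem bddBelow_norm_add (x : X) : BddBelow (Set.range fun h : {h : X // 0 ≤ h} => ‖x + h‖) :=
  ⟨0, by rintro _ ⟨h, rfl⟩; exact norm_nonneg _⟩

theorem distNegCone_le (x : X) {h : X} (hh : 0 ≤ h) : distNegCone x ≤ ‖x + h‖ :=
  ciInf_le (bddBelow_norm_add x) ⟨h, hh⟩

theorem le_distNegCone {x : X} {c : ℝ} (hc : ∀ h : X, 0 ≤ h → c ≤ ‖x + h‖) :
    c ≤ distNegCone x :=
  haveI : Nonempty {h : X // 0 ≤ h} := ⟨⟨0, le_rfl⟩⟩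
  le_ciInf fun h => hc h h.2

theorem distNegCone_nonneg (x : X) : 0 ≤ distNegCone x := le_distNegCone fun _ _ => norm_nonneg _

theorem distNegCone_le_norm (x : X) : distNegCone x ≤ ‖x‖ := by
  simpa using distNegCone_le x le_rfl

theorem distNegCone_add_le [IsOrderedAddMonoid X] (x y : X) :
    distNegCone (x + y) ≤ distNegCone x + distNegCone y := by
  rw [← sub_le_iff_le_add]
  refine le_distNegCone fun h hh => ?_
  rw [sub_le_comm]
  refine le_distNegCone fun k hk => ?_
  rw [sub_le_iff_le_add']
  calc distNegCone (x + y) ≤ ‖x + y + (h + k)‖ := distNegCone_le _ (add_nonneg hh hk)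
    _ = ‖(x + h) + (y + k)‖ := by congr 1; abel
    _ ≤ _ := norm_add_le _ _

theorem distNegCone_neg_of_nonneg {x : X} (hx : 0 ≤ x) : distNegCone (-x) = 0 :=
  le_antisymm (by simpa using distNegCone_le (-x) hx) (distNegCone_nonneg _)

/-- For positive `h` and `k`, normality applies to `x - k ≤ x ≤ x + h`; then take infima over `h`
and `k`. -/
theorem HasNormalNorm.norm_le_distNegCone [IsOrderedAddMonoid X] (hX : HasNormalNorm X) (x : X) :
    ‖x‖ ≤ distNegCone x + distNegCone (-x) := by
  rw [← sub_le_iff_le_add]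
  refine le_distNegCone fun h hh => ?_
  rw [sub_le_comm]
  refine le_distNegCone fun k hk => ?_
  rw [sub_le_iff_le_add', ← norm_neg (-x + k)]
  refine hX _ _ _ ?_ (le_add_of_nonneg_right hh)
  have : -(-x + k) = x - k := by abel
  rw [this]
  exact sub_le_self x hk

/-- An order continuous norm that is normal takes nets that decrease to zero, over directed sets in
any universe, to nets that converge to zero. -/
theorem HasOrderContinuousNorm.tendsto_norm (hX : HasOrderContinuousNorm X) (hN : HasNormalNorm X)
    {Ω : Type w} [Preorder Ω] [IsDirectedOrder Ω] [Nonempty Ω] {x : Ω → X}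
    (hx : DecreasesToZero x) : Tendsto (fun α => ‖x α‖) atTop (𝓝 0) := by
  -- The range of the net with the reversed order is a directed set in the universe of `X`, and its
  -- inclusion into `X` decreases to zero.
  let R : Type u := {r : Xᵒᵈ // ∃ α, OrderDual.toDual (x α) = r}
  have : Nonempty R := ⟨⟨_, Classical.arbitrary Ω, rfl⟩⟩
  have : IsDirectedOrder R := ⟨by
    rintro ⟨_, α, rfl⟩ ⟨_, β, rfl⟩
    obtain ⟨γ, hα, hβ⟩ := exists_ge_ge α β
    exact ⟨⟨_, γ, rfl⟩, hx.1 hα, hx.1 hβ⟩⟩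
  have hR : DecreasesToZero fun r : R => OrderDual.ofDual r.1 := by
    refine ⟨fun r s h => h, ?_⟩
    have : (Set.range fun r : R => OrderDual.ofDual r.1) = Set.range x := by
      ext v
      constructor
      · rintro ⟨⟨_, α, rfl⟩, rfl⟩
        exact ⟨α, rfl⟩
      · rintro ⟨α, rfl⟩
        exact ⟨⟨_, α, rfl⟩, rfl⟩
    rw [this]
    exact hx.2
  have hlim := hX R _ hR
  refine Metric.tendsto_nhds.2 fun ε hε => ?_
  -- One small `x α` suffices: `0 ≤ x β ≤ x α` for `β ≥ α`, and normality with lower bound `0` gives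
  -- `‖x β‖ ≤ ‖x α‖`.
  obtain ⟨⟨_, α, rfl⟩, hr⟩ := (Metric.tendsto_nhds.1 hlim ε hε).exists
  filter_upwards [eventually_ge_atTop α] with β hβ
  have h := hN (x α) (x β) 0 (hx.2.1 ⟨β, rfl⟩) (hx.1 hβ)
  simp only [norm_zero, add_zero, dist_zero_right, norm_norm, OrderDual.ofDual_toDual] at hr h ⊢
  exact h.trans_lt hr

end OrderedNormedGroup

/-! ### The order of the dual -/

section Dual

variable {X : Type u} [NormedAddCommGroup X] [NormedSpace ℝ X] [Preorder X]

theorem strongDual_neg_le_of_nonneg {f g : StrongDual ℝ X} (hf : 0 ≤ f) (hg : 0 ≤ g) :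
    -f ≤ g := fun x hx =>
  (neg_nonpos.2 (hf x hx)).trans (hg x hx)

instance strongDual_isOrderedAddMonoid : IsOrderedAddMonoid (StrongDual ℝ X) where
  add_le_add_left f g h k x hx := by simpa using h x hx

instance strongDual_posSMulMono : PosSMulMono ℝ (StrongDual ℝ X) where
  smul_le_smul_of_nonneg_left c hc f g h x hx := by
    simpa using mul_le_mul_of_nonneg_left (h x hx) hc

/-- If `h ≤ f ≤ g` and `x = a - b` is the decomposition, then `f x ≤ g a - h b ≤ (‖g‖ + ‖h‖) ‖x‖`,
and symmetrically from below. -/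
theorem HasPositiveDecomposition.hasNormalNorm_strongDual (hX : HasPositiveDecomposition X) :
    HasNormalNorm (StrongDual ℝ X) := by
  intro g f h hhf hfg
  refine f.opNorm_le_bound (by positivity) fun x => ?_
  obtain ⟨a, b, ha, hb, hax, hbx, rfl⟩ := hX x
  have e1 := hfg a ha
  have e2 := hfg b hb
  have e3 := hhf a ha
  have e4 := hhf b hb
  have bd : ∀ (k : StrongDual ℝ X) (c : X), ‖c‖ ≤ ‖a - b‖ → |k c| ≤ ‖k‖ * ‖a - b‖ :=
    fun k c hc => (k.le_opNorm c).trans (mul_le_mul_of_nonneg_left hc (norm_nonneg k))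
  have f1 := abs_le.1 (bd g a hax)
  have f2 := abs_le.1 (bd g b hbx)
  have f3 := abs_le.1 (bd h a hax)
  have f4 := abs_le.1 (bd h b hbx)
  rw [map_sub, Real.norm_eq_abs, abs_le]
  constructor <;> linarith [f1.1, f1.2, f2.1, f2.2, f3.1, f3.2, f4.1, f4.2]

theorem distNegCone_smul [PosSMulMono ℝ X] {c : ℝ} (hc : 0 < c) (x : X) :
    distNegCone (c • x) = c * distNegCone x := by
  have key : ∀ {c : ℝ}, 0 < c → ∀ x : X, c * distNegCone x ≤ distNegCone (c • x) := by
    intro c hc x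
    refine le_distNegCone fun h hh => ?_
    calc c * distNegCone x ≤ c * ‖x + c⁻¹ • h‖ :=
          mul_le_mul_of_nonneg_left (distNegCone_le x (smul_nonneg (inv_nonneg.2 hc.le) hh)) hc.le
      _ = ‖c • (x + c⁻¹ • h)‖ := by rw [norm_smul, Real.norm_of_nonneg hc.le]
      _ = ‖c • x + h‖ := by rw [smul_add, smul_inv_smul₀ hc.ne']
  refine le_antisymm ?_ (key hc x)
  have := key (inv_pos.2 hc) (c • x)
  rwa [inv_smul_smul₀ hc.ne', inv_mul_le_iff₀ hc] at this

/-- Hahn–Banach on `X × X`: the functional `(x, -x) ↦ f x` on the antidiagonal `D` lies below the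
sublinear `N` by normality. The restrictions of an extension to the two factors are `a` and `b`, and
evaluating it at `(x, -x)` gives `f = a - b`. -/
theorem HasNormalNorm.hasPositiveDecomposition_strongDual [IsOrderedAddMonoid X] [PosSMulMono ℝ X]
    (hX : HasNormalNorm X) : HasPositiveDecomposition (StrongDual ℝ X) := by
  intro f
  let N : X × X → ℝ := fun x => ‖f‖ * (distNegCone x.1 + distNegCone x.2)
  let D : Submodule ℝ (X × X) := LinearMap.ker (LinearMap.fst ℝ X X + LinearMap.snd ℝ X X)
  obtain ⟨g, hgf, hgN⟩ := exists_extension_of_le_sublinear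
    ((f.toLinearMap.comp (LinearMap.fst ℝ X X)).toPMap D) N
    (fun c hc x => by
      simp only [N, Prod.smul_fst, Prod.smul_snd, distNegCone_smul hc]; ring)
    (fun x y => by
      simp only [N, Prod.fst_add, Prod.snd_add, ← mul_add]
      refine mul_le_mul_of_nonneg_left ?_ (norm_nonneg f)
      linarith [distNegCone_add_le x.1 y.1, distNegCone_add_le x.2 y.2])
    (fun x => by
      obtain ⟨⟨x, y⟩, hxy⟩ := x
      have hy : y = -x := by
        rw [eq_neg_iff_add_eq_zero, add_comm]; simpa [D] using hxy
      subst hy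
      refine (le_abs_self _).trans ((f.le_opNorm x).trans ?_)
      exact mul_le_mul_of_nonneg_left (hX.norm_le_distNegCone x) (norm_nonneg f))
  have d0 : distNegCone (0 : X) = 0 := by simpa using distNegCone_neg_of_nonneg (le_refl (0 : X))
  -- This bound contains both properties: `distNegCone` vanishes on the negative cone, which gives
  -- positivity, and is at most the norm, which gives `‖k'‖ ≤ ‖f‖`.
  have main : ∀ k : X →ₗ[ℝ] ℝ, (∀ x, k x ≤ ‖f‖ * distNegCone x) →
      ∃ k' : StrongDual ℝ X, (∀ x, k' x = k x) ∧ 0 ≤ k' ∧ ‖k'‖ ≤ ‖f‖ := by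
    intro k hk
    have hk' : ∀ x, k x ≤ ‖f‖ * ‖x‖ := fun x =>
      (hk x).trans (mul_le_mul_of_nonneg_left (distNegCone_le_norm x) (norm_nonneg f))
    refine ⟨k.mkContinuous ‖f‖ fun x => ?_, fun x => rfl, fun x hx => ?_,
      k.mkContinuous_norm_le (norm_nonneg f) _⟩
    · rw [Real.norm_eq_abs, abs_le']
      exact ⟨hk' x, by simpa using hk' (-x)⟩
    · have := hk (-x)
      rw [distNegCone_neg_of_nonneg hx, map_neg, mul_zero] at this
      simpa using this
  obtain ⟨a, haeq, ha0, ha⟩ := main (g.comp (LinearMap.inl ℝ X X)) fun x => by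
    simpa [N, d0] using hgN (x, 0)
  obtain ⟨b, hbeq, hb0, hb⟩ := main (g.comp (LinearMap.inr ℝ X X)) fun x => by
    simpa [N, d0] using hgN (0, x)
  refine ⟨a, b, ha0, hb0, ha, hb, ?_⟩
  ext x
  have h := hgf ⟨(x, -x), by simp [D]⟩
  have hx : ((x, -x) : X × X) = (x, 0) - (0, x) := by simp
  simp only [_root_.sub_apply, haeq, hbeq, LinearMap.comp_apply, LinearMap.inl_apply,
    LinearMap.inr_apply, ← map_sub, ← hx]
  exact h.symm

/-- The sum of `(u - z) (g + f) ≥ 0` and `(u + z) (g - f) ≥ 0` is `2 (u g - z f)`; exchanging the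
signs of `z` gives the other bound. -/
theorem abs_strongDual_apply_le {z u : StrongDual ℝ X} {f g : X} [IsOrderedAddMonoid X]
    (hz : -u ≤ z) (hz' : z ≤ u) (hf : -g ≤ f) (hf' : f ≤ g) : |z f| ≤ u g := by
  have h1 : 0 ≤ g + f := by simpa using add_le_add_right hf g
  have h2 : 0 ≤ g - f := sub_nonneg.2 hf'
  have a1 := hz _ h1
  have a2 := hz _ h2
  have a3 := hz' _ h1
  have a4 := hz' _ h2
  simp only [_root_.neg_apply, map_add, map_sub] at a1 a2 a3 a4
  rw [abs_le]
  constructor <;> linarith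

/-- A net in the dual that decreases to zero converges to zero pointwise on the positive cone. -/
theorem DecreasesToZero.tendsto_apply (hX : HasPositiveDecomposition X) {Ω : Type w} [Preorder Ω]
    [IsDirectedOrder Ω] [Nonempty Ω] {y : Ω → StrongDual ℝ X} (hy : DecreasesToZero y)
    {x : X} (hx : 0 ≤ x) : Tendsto (fun α => y α x) atTop (𝓝 0) := by
  have hy0 : ∀ α, ∀ x : X, 0 ≤ x → 0 ≤ y α x := fun α => hy.2.1 ⟨α, rfl⟩
  have hanti : ∀ x : X, 0 ≤ x → Antitone fun α => y α x := fun x hx α β h => hy.1 h x hx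
  have hlim0 : ∀ x : X, 0 ≤ x → ∃ l, Tendsto (fun α => y α x) atTop (𝓝 l) := fun x hx =>
    ⟨_, tendsto_atTop_ciInf (hanti x hx) ⟨0, by rintro _ ⟨α, rfl⟩; exact hy0 α x hx⟩⟩
  have hlim : ∀ x : X, ∃ l, Tendsto (fun α => y α x) atTop (𝓝 l) := fun x => by
    obtain ⟨a, b, ha, hb, -, -, rfl⟩ := hX x
    obtain ⟨l, hl⟩ := hlim0 a ha
    obtain ⟨k, hk⟩ := hlim0 b hb
    exact ⟨l - k, by simpa using hl.sub hk⟩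
  choose L hL using hlim
  obtain ⟨α₀⟩ := ‹Nonempty Ω›
  -- The pointwise limit is a bounded functional: for `α ≥ α₀` and `x = a - b`, both `y α a` and `y
  -- α b` lie in `[0, ‖y α₀‖ ‖x‖]`. As a lower bound of the net it is at most `0`.
  let g : StrongDual ℝ X := (linearMapOfTendsto L (fun α => (y α).toLinearMap)
    (tendsto_pi_nhds.2 hL)).mkContinuous ‖y α₀‖ fun x => by
      refine le_of_tendsto (hL x).norm ((eventually_ge_atTop α₀).mono fun α hα => ?_)
      obtain ⟨a, b, ha, hb, ha', hb', hab⟩ := hX x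
      have bd : ∀ c : X, 0 ≤ c → ‖c‖ ≤ ‖x‖ → y α c ≤ ‖y α₀‖ * ‖x‖ := fun c hc hcx =>
        (hanti c hc hα).trans ((le_abs_self _).trans (((y α₀).le_opNorm c).trans
          (mul_le_mul_of_nonneg_left hcx (norm_nonneg _))))
      rw [hab, map_sub, Real.norm_eq_abs, abs_le, ← hab]
      constructor <;> linarith [bd a ha ha', bd b hb hb', hy0 α a ha, hy0 α b hb]
  have hg : g ≤ 0 := hy.2.2 (by
    rintro _ ⟨α, rfl⟩ x hx
    exact (hanti x hx).le_of_tendsto (hL x) α)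
  have h1 : L x ≤ 0 := hg x hx
  have h2 : 0 ≤ L x := ge_of_tendsto' (hL x) fun α => hy0 α x hx
  have := hL x
  rwa [le_antisymm h1 h2] at this

theorem decreasesToZero_of_tendsto_apply {Ω : Type w} [Preorder Ω] [IsDirectedOrder Ω] [Nonempty Ω]
    {y : Ω → StrongDual ℝ X} (hy : Antitone y) (hy0 : ∀ α, 0 ≤ y α)
    (hlim : ∀ x : X, 0 ≤ x → Tendsto (fun α => y α x) atTop (𝓝 0)) : DecreasesToZero y :=
  ⟨hy, by rintro _ ⟨α, rfl⟩; exact hy0 α, fun _ hw x hx =>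
    ge_of_tendsto' (hlim x hx) fun α => hw ⟨α, rfl⟩ x hx⟩

end Dual

/-! ### Norm conditions in Banach lattices -/

section BanachLattice

variable (E : Type u) [NormedAddCommGroup E] [Lattice E] [IsOrderedAddMonoid E] [HasSolidNorm E]

theorem hasPositiveDecomposition_of_hasSolidNorm : HasPositiveDecomposition E := fun x =>
  ⟨x⁺, x⁻, posPart_nonneg x, negPart_nonneg x,
    norm_le_norm_of_abs_le_abs (by
      rw [abs_of_nonneg (posPart_nonneg x), ← posPart_add_negPart x]
      exact le_add_of_nonneg_right (negPart_nonneg x)),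
    norm_le_norm_of_abs_le_abs (by
      rw [abs_of_nonneg (negPart_nonneg x), ← posPart_add_negPart x]
      exact le_add_of_nonneg_left (posPart_nonneg x)),
    (posPart_sub_negPart x).symm⟩

theorem hasNormalNorm_of_hasSolidNorm : HasNormalNorm E := fun a x b hb ha => by
  rw [← norm_abs_eq_norm a, ← norm_abs_eq_norm b]
  refine (norm_le_norm_of_abs_le_abs ?_).trans (norm_add_le _ _)
  rw [abs_of_nonneg (add_nonneg (abs_nonneg a) (abs_nonneg b)), abs_le']
  constructor
  · exact ha.trans ((le_abs_self a).trans (le_add_of_nonneg_right (abs_nonneg b)))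
  · exact (neg_le_neg hb).trans ((neg_le_abs b).trans (le_add_of_nonneg_left (abs_nonneg a)))

end BanachLattice

/-! ### Estimates for iterated evaluations -/

section ArensForm

variable {Ω : Type w} [Preorder Ω] [IsDirectedOrder Ω] [Nonempty Ω]

theorem fin_cons_nonneg {n : ℕ} {G : Fin (n + 1) → Type u} [∀ i, Zero (G i)]
    [∀ i, Preorder (G i)] {t : G 0} {x : ∀ i : Fin n, G i.succ} (ht : 0 ≤ t) (hx : ∀ i, 0 ≤ x i) :
    ∀ i, 0 ≤ (Fin.cons t x : ∀ i, G i) i :=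
  Fin.cases ht hx

/-- By induction, as `abs_strongDual_apply_le` carries the domination of forms through one
elimination. This one estimate yields monotonicity, positivity and domination of the net in the main
theorem. -/
theorem abs_arensForm_le {n : ℕ} {G : Fin n → Type u} [∀ i, NormedAddCommGroup (G i)]
    [∀ i, NormedSpace ℝ (G i)] [∀ i, Preorder (G i)] {z u : ∀ i, Bidual (G i)}
    (hz : ∀ i, -u i ≤ z i) (hz' : ∀ i, z i ≤ u i) {B C : ContinuousMultilinearMap ℝ G ℝ}
    (hBC : ∀ x : ∀ i, G i, (∀ i, 0 ≤ x i) → |B x| ≤ C x) :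
    |arensForm G z B| ≤ arensForm G u C := by
  induction n with
  | zero => exact hBC 0 fun i => i.elim0
  | succ n ih =>
    refine ih (fun i => hz i.succ) (fun i => hz' i.succ) fun x hx => ?_
    change |z 0 (B.curryLeft.flipMultilinear x)| ≤ u 0 (C.curryLeft.flipMultilinear x)
    refine abs_strongDual_apply_le (hz 0) (hz' 0) (fun t ht => ?_) fun t ht => ?_
    · exact (abs_le.1 (hBC _ (fin_cons_nonneg ht hx))).1
    · exact (abs_le.1 (hBC _ (fin_cons_nonneg ht hx))).2

/-- For positive functionals, the iterated evaluation of a decreasing net of positive forms that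
converges to zero pointwise converges to zero, if the norms of the duals are order continuous. -/
theorem tendsto_arensForm_of_tendsto_apply {n : ℕ} {G : Fin n → Type u}
    [∀ i, NormedAddCommGroup (G i)] [∀ i, NormedSpace ℝ (G i)] [∀ i, Preorder (G i)]
    (hG : ∀ i, HasPositiveDecomposition (G i))
    (hG' : ∀ i, HasOrderContinuousNorm (StrongDual ℝ (G i)))
    {z : ∀ i, Bidual (G i)} (hz : ∀ i, 0 ≤ z i) {B : Ω → ContinuousMultilinearMap ℝ G ℝ}
    (hB0 : ∀ α, ∀ x : ∀ i, G i, (∀ i, 0 ≤ x i) → 0 ≤ B α x)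
    (hB : ∀ x : ∀ i, G i, (∀ i, 0 ≤ x i) → Antitone fun α => B α x)
    (hlim : ∀ x : ∀ i, G i, (∀ i, 0 ≤ x i) → Tendsto (fun α => B α x) atTop (𝓝 0)) :
    Tendsto (fun α => arensForm G z (B α)) atTop (𝓝 0) := by
  induction n with
  | zero => exact hlim 0 fun i => i.elim0
  | succ n ih =>
    refine ih (fun i => hG i.succ) (fun i => hG' i.succ) (fun i => hz i.succ)
      (B := fun α => arensStep (z 0) (B α)) (fun α x hx => ?_) (fun x hx α β h => ?_)
      fun x hx => ?_
    · exact hz 0 _ fun t ht => hB0 α _ (fin_cons_nonneg ht hx)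
    · have := hz 0 ((B α).curryLeft.flipMultilinear x - (B β).curryLeft.flipMultilinear x)
        fun t ht => sub_nonneg.2 (hB _ (fin_cons_nonneg ht hx) h)
      simpa [arensStep_apply] using this
    -- Order continuity of the norm enters here: it turns pointwise decrease to zero into norm
    -- convergence, which `z 0` preserves.
    · have h1 : DecreasesToZero fun α => (B α).curryLeft.flipMultilinear x :=
        decreasesToZero_of_tendsto_apply
          (fun α β h t ht => hB _ (fin_cons_nonneg ht hx) h)
          (fun α t ht => hB0 α _ (fin_cons_nonneg ht hx))
          fun t ht => hlim _ (fin_cons_nonneg ht hx)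
      have h2 := (hG' 0).tendsto_norm (hG 0).hasNormalNorm_strongDual h1
      have h3 := ((z 0).continuous.tendsto 0).comp (tendsto_zero_iff_norm_tendsto_zero.2 h2)
      rw [map_zero] at h3
      exact h3

/-- The iterated evaluation of a positive form at positive functionals, one of which runs through a
net that decreases to zero, converges to zero if the norms of the duals of the later factors are
order continuous. -/
theorem tendsto_arensForm_of_decreasesToZero {n : ℕ} {G : Fin n → Type u}
    [∀ i, NormedAddCommGroup (G i)] [∀ i, NormedSpace ℝ (G i)] [∀ i, Preorder (G i)]
    (hG : ∀ i, HasPositiveDecomposition (G i)) (k : Fin n)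
    (hk : HasPositiveDecomposition (StrongDual ℝ (G k)))
    (hG' : ∀ i, k < i → HasOrderContinuousNorm (StrongDual ℝ (G i)))
    {z : Ω → ∀ i, Bidual (G i)} {u : ∀ i, Bidual (G i)} (hu : ∀ i, 0 ≤ u i)
    (hzu : ∀ α i, i ≠ k → z α i = u i) (hzk : DecreasesToZero fun α => z α k)
    {B : ContinuousMultilinearMap ℝ G ℝ} (hB : ∀ x : ∀ i, G i, (∀ i, 0 ≤ x i) → 0 ≤ B x) :
    Tendsto (fun α => arensForm G (z α) B) atTop (𝓝 0) := by
  induction n with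
  | zero => exact k.elim0
  | succ n ih =>
    revert hk hG' hzu hzk
    refine Fin.cases (fun hk hG' hzu hzk => ?_) (fun k hk hG' hzu hzk => ?_) k
    -- The varying functional comes first: its elimination produces a decreasing net of forms, and
    -- the remaining functionals are fixed.
    · have hz : ∀ α, (fun i : Fin n => z α i.succ) = fun i : Fin n => u i.succ := fun α =>
        funext fun i => hzu α _ (Fin.succ_ne_zero i)
      have hpos : ∀ x : ∀ i : Fin n, G i.succ, (∀ i, 0 ≤ x i) → 0 ≤ B.curryLeft.flipMultilinear x :=
        fun x hx t ht => hB _ (fin_cons_nonneg ht hx)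
      simp only [arensForm, ContinuousLinearMap.comp_apply, hz]
      refine tendsto_arensForm_of_tendsto_apply (fun i => hG i.succ)
        (fun i => hG' _ (Fin.succ_pos i)) (fun i => hu i.succ) (fun α x hx => ?_)
        (fun x hx α β h => ?_) fun x hx => ?_
      · exact hzk.2.1 ⟨α, rfl⟩ _ (hpos x hx)
      · exact hzk.1 h _ (hpos x hx)
      · exact hzk.tendsto_apply hk (hpos x hx)
    · have hz : ∀ α, z α 0 = u 0 := fun α => hzu α 0 (Fin.succ_ne_zero k).symm
      simp only [arensForm, ContinuousLinearMap.comp_apply, hz]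
      exact ih (fun i => hG i.succ) k hk (fun i hi => hG' _ (Fin.succ_lt_succ_iff.2 hi))
        (z := fun α i => z α i.succ) (fun i => hu i.succ)
        (fun α i hi => hzu α _ fun h => hi (Fin.succ_injective n h)) hzk
        fun x hx => hu 0 _ fun t ht => hB _ (fin_cons_nonneg ht hx)

/-- The tuple `x'` does not depend on `A`, so different operators can be compared at the same
positive vectors. -/
theorem permuteVariables_eq {m : ℕ} {E : Fin m → Type u} {F : Type v}
    [∀ i, NormedAddCommGroup (E i)] [∀ i, NormedSpace ℝ (E i)] [∀ i, Preorder (E i)]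
    [NormedAddCommGroup F] [NormedSpace ℝ F] (ρ : Equiv.Perm (Fin m)) (x : ∀ k, E (ρ k))
    (hx : ∀ k, 0 ≤ x k) : ∃ x' : ∀ i, E i, (∀ i, 0 ≤ x' i) ∧
      ∀ A : ContinuousMultilinearMap ℝ E F, permuteVariables ρ A x = A x' := by
  refine ⟨(ρ.symm.piCongrLeft' E).symm x, fun i => ?_, fun A => rfl⟩
  obtain ⟨k, rfl⟩ := ρ.surjective i
  exact (hx k).trans_eq (Equiv.piCongrLeft_apply_apply E ρ x k).symm

end ArensForm

/-! ### Separate order continuity of the Arens extension -/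

theorem mainTheorem6 {m : ℕ} (hm : 0 < m) (E : Fin m → Type u) (F : Type v)
    [∀ i, NormedAddCommGroup (E i)] [∀ i, NormedSpace ℝ (E i)] [∀ i, CompleteSpace (E i)]
    [∀ i, Lattice (E i)] [∀ i, IsOrderedAddMonoid (E i)] [∀ i, IsOrderedModule ℝ (E i)]
    [∀ i, HasSolidNorm (E i)]
    [NormedAddCommGroup F] [NormedSpace ℝ F] [CompleteSpace F]
    [Lattice F] [IsOrderedAddMonoid F] [IsOrderedModule ℝ F] [HasSolidNorm F]
    (A : MultilinearMap ℝ E F) (hA : IsRegularMultilinear A) (ρ : Equiv.Perm (Fin m))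
    (hE : ∀ j : Fin m, j ≠ ρ ⟨0, hm⟩ → HasOrderContinuousNorm (StrongDual ℝ (E j))) :
    SeparatelyOrderContinuous.{u, v, w} (E := fun i => Bidual (E i)) (F := Bidual F)
      (arensExtension ρ A hA) := by
  obtain ⟨A₁, A₂, h₁, h₂, hA₁₂⟩ := id hA
  have hE1 : ∀ i, HasPositiveDecomposition (E i) := fun i =>
    hasPositiveDecomposition_of_hasSolidNorm (E i)
  have hE2 : ∀ i, HasPositiveDecomposition (StrongDual ℝ (E i)) := fun i =>
    (hasNormalNorm_of_hasSolidNorm (E i)).hasPositiveDecomposition_strongDual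
  have hE3 : ∀ i, HasPositiveDecomposition (Bidual (E i)) := fun i =>
    (hE1 i).hasNormalNorm_strongDual.hasPositiveDecomposition_strongDual
  let Ac : ContinuousMultilinearMap ℝ E F := { toMultilinearMap := A, cont := hA.continuous }
  let S : ContinuousMultilinearMap ℝ E F :=
    { toMultilinearMap := A₁ + A₂, cont := h₁.continuous.add h₂.continuous }
  have hdom : ∀ y : StrongDual ℝ F, 0 ≤ y → ∀ x : ∀ k, E (ρ k), (∀ k, 0 ≤ x k) →
      |y.compContinuousMultilinearMap (permuteVariables ρ Ac) x| ≤
        y.compContinuousMultilinearMap (permuteVariables ρ S) x := by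
    intro y hy x hx
    obtain ⟨x', hx', hperm⟩ := permuteVariables_eq (F := F) ρ x hx
    have e1 := hy _ (h₁ x' hx')
    have e2 := hy _ (h₂ x' hx')
    have eA : Ac x' = A₁ x' - A₂ x' := by
      change A x' = _
      rw [hA₁₂]; rfl
    have eS : S x' = A₁ x' + A₂ x' := rfl
    simp only [ContinuousLinearMap.compContinuousMultilinearMap_coe, Function.comp_apply, hperm,
      eA, eS, map_add, map_sub]
    simp only [_root_.zero_apply] at e1 e2
    rw [abs_le]
    constructor <;> linarith
  have hpos : ∀ y : StrongDual ℝ F, 0 ≤ y → ∀ x : ∀ k, E (ρ k), (∀ k, 0 ≤ x k) →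
      0 ≤ y.compContinuousMultilinearMap (permuteVariables ρ S) x := fun y hy x hx =>
    (abs_nonneg _).trans (hdom y hy x hx)
  intro j z Ω _ _ _ v ⟨y, hy, hvy⟩
  choose u hu hu' using fun i => (hE3 i).exists_abs_le (z i)
  have hu0 : ∀ i, 0 ≤ u i := fun i f hf => by
    have e1 := hu i f hf
    have e2 := hu' i f hf
    simp only [_root_.neg_apply, _root_.zero_apply] at e1 ⊢
    linarith
  have hy0 : ∀ α, 0 ≤ y α := fun α => hy.2.1 ⟨α, rfl⟩
  have hmono : ∀ {a b : Bidual (E j)}, -b ≤ a → a ≤ b → ∀ i,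
      -Function.update u j b i ≤ Function.update u j a i ∧
        Function.update u j a i ≤ Function.update u j b i := by
    intro a b h h' i
    by_cases hi : i = j
    · subst hi
      simpa using ⟨h, h'⟩
    · simpa [Function.update_of_ne hi] using strongDual_neg_le_of_nonneg (hu0 i) (hu0 i)
  have hzu : ∀ α i, -Function.update u j (y α) i ≤ Function.update z j (v α) i ∧
      Function.update z j (v α) i ≤ Function.update u j (y α) i := by
    intro α i
    by_cases hi : i = j
    · subst hi
      simpa using hvy α
    · simpa only [Function.update_of_ne hi] using ⟨hu i, hu' i⟩
  -- The dominating net. The remaining goals are its monotonicity, positivity and pointwise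
  -- convergence to zero, and the two inequalities of the domination.
  refine ⟨fun α => arensExtensionOfContinuous ρ S (Function.update u j (y α)),
    decreasesToZero_of_tendsto_apply ?_ ?_ ?_, fun α => ⟨?_, ?_⟩⟩
  · intro α β h f hf
    have hle := hmono (strongDual_neg_le_of_nonneg (hy0 α) (hy0 β)) (hy.1 h)
    refine (le_abs_self _).trans (abs_arensForm_le (fun k => (hle (ρ k)).1)
      (fun k => (hle (ρ k)).2) fun x hx => ?_)
    exact (abs_of_nonneg (hpos f hf x hx)).le
  · intro α f hf
    exact (abs_nonneg _).trans (abs_arensForm_le (fun k => (hzu α (ρ k)).1)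
      (fun k => (hzu α (ρ k)).2) (hdom f hf))
  · intro f hf
    obtain ⟨k, rfl⟩ := ρ.surjective j
    refine tendsto_arensForm_of_decreasesToZero (fun i => hE1 (ρ i)) k (hE2 (ρ k))
      (fun i hi => hE _ fun h => ?_) (u := fun i => u (ρ i)) (fun i => hu0 (ρ i))
      (fun α i hi => Function.update_of_ne (fun h => hi (ρ.injective h)) _ _) ?_ (hpos f hf)
    -- A position `i > k` is not the first one, so `ρ i` is not the variable exempt from the
    -- hypothesis.
    · have := ρ.injective h
      subst this
      exact absurd hi (Nat.not_lt_zero _)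
    · simpa using hy
  · intro f hf
    exact (abs_le.1 (abs_arensForm_le (fun k => (hzu α (ρ k)).1)
      (fun k => (hzu α (ρ k)).2) (hdom f hf))).1
  · intro f hf
    exact (abs_le.1 (abs_arensForm_le (fun k => (hzu α (ρ k)).1)
      (fun k => (hzu α (ρ k)).2) (hdom f hf))).2
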